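/- **Setting.** Let $\Sigma_{\mathrm{OL}}=\{\neg,\lor,\land,\to\}$ ($\neg$ unary, the others binary), and let $\Sigma$ be a propositional signature (a set of connectives with finite arities, possibly containing connectives outside $\Sigma_{\mathrm{OL}}$) with $\{\neg,\to\}\subseteq\Sigma$. Formulas over $\Sigma$ are built from countably infinitely many propositional variables. An *$\mathrm{OL}$-matrix* over $\Sigma$ is an algebra $\mathbf A$ over $\Sigma$ with carrier $\{\mathbf 0,\mathbf{1/2},\mathbf 1\}$, with set of designated values $D=\{\mathbf{1/2},\mathbf 1\}$, in which the connectives in $\Sigma\cap\Sigma_{\mathrm{OL}}$ are interpreted as follows: $\neg\mathbf 0=\mathbf 1$, $\neg\mathbf 1=\mathbf 0$, $\neg\mathbf{1/2}=\mathbf{1/2}$; $x\to y=y$ if $x\neq\mathbf 0$, and $\mathbf 0\to y=\mathbf{1/2}$; $\land$ and $\lor$ are the minimum and the maximum on $\{\mathbf 0,\mathbf 1\}$, and $x\circ\mathbf{1/2}=\mathbf{1/2}\circ x=x$ for all $x$ and $\circ\in\{\land,\lor\}$; connectives outside $\Sigma_{\mathrm{OL}}$ are interpreted arbitrarily. For an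 $\mathrm{OL}$-matrix $\mathbb M$, $\Gamma\vdash_{\mathbb M}\psi$ means that no homomorphism $v$ from the formula algebra to $\mathbf A$ has $v[\Gamma]\subseteq D$ and $v(\psi)\notin D$ (for $\Sigma=\Sigma_{\mathrm{OL}}$ this is $\mathrm{sOL}$). **The multiple-conclusion calculus $\mathsf R_\Sigma$.** Write $\Phi\,/\,\Psi$ for the rule with premises $\Phi$ and conclusions $\Psi$. Let $\mathsf R_\Sigma=\bigcup_{©\in\Sigma}\mathsf R_©$, where * $\mathsf R_\neg$: $\;p/\neg\neg p$; $\;\neg\neg p/p$; $\;\varnothing/p,\neg p$. * $\mathsf R_\to$: $\;p,p\to q/q$; $\;q/p\to q$; $\;\varnothing/p,p\to q$; $\;p,\neg(p\to q)/\neg q$; $\;\neg q/\neg(p\to q)$; $\;\varnothing/p,\neg(p\to q)$. * $\mathsf R_\lor$: $\;\varnothing/\neg p,p\lor q$; $\;\varnothing/\neg q,p\lor q$; $\;\neg(p\lor q)/\neg p$; $\;\neg(p\lor q)/\neg q$; $\;\neg(p\lor q),p\lor q/p$; $\;\neg(p\lor q),p\lor q/q$; $\;\neg p,\neg q/\neg(p\lor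 q)$; $\;\neg p,p\lor q/q$; $\;\neg q,p\lor q/p$; $\;p\lor q/p,q$; $\;p,q/p\lor q$. * $\mathsf R_\land$: $\;p\land q/p$; $\;p\land q/q$; $\;p,q/p\land q$; $\;p\land q,\neg(p\land q)/\neg p$; $\;p\land q,\neg(p\land q)/\neg q$; $\;\neg p,\neg q/\neg(p\land q)$; $\;p/p\land q,\neg q$; $\;q/p\land q,\neg p$. * For a $k$-ary $©\in\Sigma\setminus\Sigma_{\mathrm{OL}}$, $\mathsf R_©$ consists of the rules generated from its truth table with the separators $p,\neg p$: for all values $x_1,\dots,x_k$ and every $y\neq ©_{\mathbf A}(x_1,\dots,x_k)$, the rule $$\textstyle\bigcup_i\Omega_{x_i}(p_i)\cup\Omega_y(©(p_1,\dots,p_k))\;\big/\;\bigcup_i\mho_{x_i}(p_i)\cup\mho_y(©(p_1,\dots,p_k)),$$ where $\Omega_{\mathbf 1}(\varphi)=\{\varphi\}$, $\mho_{\mathbf 1}(\varphi)=\{\neg\varphi\}$; $\Omega_{\mathbf{1/2}}(\varphi)=\{\varphi,\neg\varphi\}$, $\mho_{\mathbf{1/2}}(\varphi)=\varnothing$; $\Omega_{\mathbf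 0}(\varphi)=\{\neg\varphi\}$, $\mho_{\mathbf 0}(\varphi)=\{\varphi\}$. **The single-conclusion calculus $\mathsf R_\Sigma^\to$.** It consists of the rules and axioms of intuitionistic implication, that is, modus ponens $p,p\to q/q$ and the axioms $p\to(q\to p)$ and $(p\to(q\to r))\to((p\to q)\to(p\to r))$, together with, for each rule $\varphi_1,\dots,\varphi_m/\psi_1,\dots,\psi_n$ in $\mathsf R_\Sigma$, the axiom $$\varphi_1\to(\cdots(\varphi_m\to((\psi_1\to p_0)\to(\cdots((\psi_n\to p_0)\to p_0)\cdots)))\cdots),$$ where $p_0$ is a propositional variable not occurring in the rule. $\Gamma\vdash_{\mathsf R_\Sigma^\to}\psi$ means that there is a (finite) Hilbert derivation of $\psi$ from $\Gamma$ using substitution instances of these rules and axioms. **Theorem.** Let $\Sigma$ be a signature with $\{\neg,\to\}\subseteq\Sigma$ and let $\mathbb M$ be an $\mathrm{OL}$-matrix over $\Sigma$. Then $\vdash_{\mathbb M}$ is axiomatized by $\mathsf R_\Sigma^\to$: for every set $\Gamma$ of formulas and every formula $\psi$ over $\Sigma$, $$\Gamma\vdash_{\mathbb M}\psi\iff\Gamma\vdash_{\mathsf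 R_\Sigma^\to}\psi.$$ -/

import Mathlib

universe u

namespace OrdinaryDiscourse

/-! ### Truth values and the truth tables of the logic of ordinary discourse -/

/-- The three truth values `0`, `1/2`, `1`. -/
inductive O3 : Type
  | zero
  | half
  | one

/-- The four connectives of `OL`: negation, disjunction, conjunction, implication. -/
inductive OLConn : Type
  | neg
  | or
  | and
  | imp

/-- Arities of the connectives of `OL`. -/
abbrev OLConn.arity : OLConn → ℕ
  | .neg => 1
  | .or => 2
  | .and => 2
  | .imp => 2

/-- Negation: swaps `0` and `1`, fixes `1/2`. -/
def O3.neg : O3 → O3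
  | .zero => .one
  | .half => .half
  | .one => .zero

/-- Conjunction. -/
def O3.and : O3 → O3 → O3
  | .half, .half => .half
  | .half, .one => .one
  | .half, .zero => .zero
  | .one, .half => .one
  | .one, .one => .one
  | .one, .zero => .zero
  | .zero, .half => .zero
  | .zero, .one => .zero
  | .zero, .zero => .zero

/-- Disjunction. -/
def O3.or : O3 → O3 → O3
  | .half, .half => .half
  | .half, .one => .one
  | .half, .zero => .zero
  | .one, .half => .one
  | .one, .one => .one
  | .one, .zero => .one
  | .zero, .half => .zero
  | .zero, .one => .one
  | .zero, .zero => .zero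

/-- Implication: the value of the consequent if the antecedent is `1/2` or `1`, and `1/2` if the
antecedent is `0`. -/
def O3.imp : O3 → O3 → O3
  | .half, .half => .half
  | .half, .one => .one
  | .half, .zero => .zero
  | .one, .half => .half
  | .one, .one => .one
  | .one, .zero => .zero
  | .zero, .half => .half
  | .zero, .one => .half
  | .zero, .zero => .half

/-- The truth table of each connective of `OL`. -/
def OLConn.table : (c : OLConn) → (Fin c.arity → O3) → O3
  | .neg, x => O3.neg (x (0 : Fin 1))
  | .or, x => O3.or (x (0 : Fin 2)) (x (1 : Fin 2))
  | .and, x => O3.and (x (0 : Fin 2)) (x (1 : Fin 2))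
  | .imp, x => O3.imp (x (0 : Fin 2)) (x (1 : Fin 2))

/-! ### Signatures, formulas, substitutions -/

/-- A propositional signature: which of the four connectives of `OL` it contains, and an arbitrary
collection of further connectives with arbitrary arities. -/
structure Signature : Type (u + 1) where
  /-- the connectives of `OL` that belong to the signature -/
  ol : Set OLConn
  /-- the other connectives of the signature -/
  Extra : Type u
  /-- the arities of the other connectives -/
  extraArity : Extra → ℕ

/-- All connectives of a signature. -/
abbrev Signature.Conn (S : Signature.{u}) : Type u := S.ol ⊕ S.Extra

/-- The arity of a connective of a signature. -/
abbrev Signature.arity (S : Signature.{u}) : S.Conn → ℕ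
  | .inl c => c.1.arity
  | .inr c => S.extraArity c

/-- Formulas over `S`, with propositional variables `p_0, p_1, p_2, …`. -/
inductive Formula (S : Signature.{u}) : Type u
  | var (n : ℕ) : Formula S
  | app (c : S.Conn) (args : Fin (S.arity c) → Formula S) : Formula S

namespace Formula

variable {S : Signature.{u}}

/-- `¬ φ` -/
def neg (h : OLConn.neg ∈ S.ol) (φ : Formula S) : Formula S :=
  .app (.inl ⟨.neg, h⟩) (fun _ => φ)

/-- `φ ∨ ψ` -/
def or (h : OLConn.or ∈ S.ol) (φ ψ : Formula S) : Formula S :=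
  .app (.inl ⟨.or, h⟩) (![φ, ψ] : Fin 2 → Formula S)

/-- `φ ∧ ψ` -/
def and (h : OLConn.and ∈ S.ol) (φ ψ : Formula S) : Formula S :=
  .app (.inl ⟨.and, h⟩) (![φ, ψ] : Fin 2 → Formula S)

/-- `φ → ψ` -/
def imp (h : OLConn.imp ∈ S.ol) (φ ψ : Formula S) : Formula S :=
  .app (.inl ⟨.imp, h⟩) (![φ, ψ] : Fin 2 → Formula S)

/-- The formula obtained by applying the substitution `σ`. -/
def subst (σ : ℕ → Formula S) : Formula S → Formula S
  | .var n => σ n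
  | .app c args => .app c (fun i => (args i).subst σ)

/-- The (indices of the) propositional variables that occur in a formula. -/
def vars : Formula S → Finset ℕ
  | .var n => {n}
  | .app _ args => Finset.univ.biUnion (fun i => (args i).vars)

end Formula

/-! ### Three-valued matrices and their consequence relations -/

/-- A three-valued matrix over `S`. -/
structure ThreeMatrix (S : Signature.{u}) : Type u where
  /-- the interpretation of the connectives -/
  interp : (c : S.Conn) → (Fin (S.arity c) → O3) → O3
  /-- the designated values -/
  D : Set O3

namespace ThreeMatrix

variable {S : Signature.{u}}

/-- `v` is an `M`-valuation: a homomorphism from the formula algebra to the algebra of `M`. -/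
def IsValuation (M : ThreeMatrix S) (v : Formula S → O3) : Prop :=
  ∀ (c : S.Conn) (args : Fin (S.arity c) → Formula S),
    v (.app c args) = M.interp c (fun i => v (args i))

/-- Single-conclusion consequence `Φ ⊢_M ψ`: no valuation designates all of `Φ` but not `ψ`. -/
def Entails (M : ThreeMatrix S) (Φ : Set (Formula S)) (ψ : Formula S) : Prop :=
  ¬ ∃ v : Formula S → O3, M.IsValuation v ∧ (∀ φ ∈ Φ, v φ ∈ M.D) ∧ v ψ ∉ M.D

/-- `M` is an `OL`-matrix: the connectives of `OL` in the signature have the `OL` truth tables,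
and the designated values are `1/2` and `1`. -/
def IsOLMatrix (M : ThreeMatrix S) : Prop :=
  (∀ c : S.ol, M.interp (.inl c) = c.1.table) ∧ M.D = {O3.half, O3.one}

end ThreeMatrix

/-! ### Hilbert calculi -/

/-- A multiple-conclusion rule with finitely many premises and conclusions. -/
structure Rule (S : Signature.{u}) : Type u where
  /-- the premises (antecedent) -/
  prem : List (Formula S)
  /-- the conclusions (succedent) -/
  concl : List (Formula S)

/-- A single-conclusion rule. -/
structure SRule (S : Signature.{u}) : Type u where
  /-- the premises -/
  prem : List (Formula S)
  /-- the conclusion -/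
  concl : Formula S

section Calculi

variable {S : Signature.{u}}

/-- A single-conclusion rule, seen as a multiple-conclusion rule. -/
def SRule.toRule (r : SRule S) : Rule S := ⟨r.prem, [r.concl]⟩

/-- `Proves R Γ Δ`: there is a finite proof tree of `(Γ, Δ)` in the multiple-conclusion calculus
`R`. A node labelled by `Γ` may be a leaf if `Γ` meets `Δ`; otherwise an instance of a rule of `R`
whose premises are in `Γ` is applied to it, and it has one child for each conclusion `ψ` of that
instance, labelled by `Γ` together with `ψ`. (If there are no conclusions the branch is
discontinued.) -/
inductive Proves (R : Set (Rule S)) : Set (Formula S) → Set (Formula S) → Prop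
  | leaf {Γ Δ : Set (Formula S)} (h : (Γ ∩ Δ).Nonempty) : Proves R Γ Δ
  | node {Γ Δ : Set (Formula S)} (r : Rule S) (hr : r ∈ R) (σ : ℕ → Formula S)
      (hprem : ∀ φ ∈ r.prem, φ.subst σ ∈ Γ)
      (hchild : ∀ ψ ∈ r.concl, Proves R (insert (ψ.subst σ) Γ) Δ) : Proves R Γ Δ

/-- `Γ ⊢_R ψ` for a single-conclusion calculus `R`. -/
def Derives (R : Set (SRule S)) (Γ : Set (Formula S)) (ψ : Formula S) : Prop :=
  Proves (SRule.toRule '' R) Γ {ψ}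

/-- The single-conclusion calculus `R` axiomatizes the relation `C`. -/
def Axiomatizes (R : Set (SRule S)) (C : Set (Formula S) → Formula S → Prop) : Prop :=
  ∀ (Γ : Set (Formula S)) (ψ : Formula S), C Γ ψ ↔ Derives R Γ ψ

/-! ### Implicational translation of a multiple-conclusion calculus -/

/-- The variables that occur in a rule. -/
def Rule.vars (r : Rule S) : Finset ℕ :=
  ((r.prem ++ r.concl).map Formula.vars).foldr (· ∪ ·) ∅

/-- The index of a variable that does not occur in the rule `r`. -/
def Rule.freshVar (r : Rule S) : ℕ := r.vars.sup id + 1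

theorem Rule.freshVar_notMem (r : Rule S) : r.freshVar ∉ r.vars := by
  intro h
  have h1 : r.freshVar ≤ r.vars.sup id := Finset.le_sup (f := id) h
  unfold Rule.freshVar at h1
  omega

/-- `{φ₁, …, φₘ} ⇀ {ψ₁, …, ψₙ}`, that is,
`φ₁ ⇀ (… (φₘ ⇀ ((ψ₁ ⇀ p₀) ⇀ (… ((ψₙ ⇀ p₀) ⇀ p₀) …))) …)`. -/
def implForm (imp : Formula S → Formula S → Formula S) (p₀ : Formula S)
    (φs ψs : List (Formula S)) : Formula S :=
  φs.foldr imp (ψs.foldr (fun ψ χ => imp (imp ψ p₀) χ) p₀)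

/-- The rules and axioms of intuitionistic implication: modus ponens and the axioms
`p ⇀ (q ⇀ p)` and `(p ⇀ (q ⇀ r)) ⇀ ((p ⇀ q) ⇀ (p ⇀ r))`. -/
def intImpRules (imp : Formula S → Formula S → Formula S) : Set (SRule S) :=
  let p : Formula S := .var 0
  let q : Formula S := .var 1
  let r : Formula S := .var 2
  { ⟨[p, imp p q], q⟩,
    ⟨[], imp p (imp q p)⟩,
    ⟨[], imp (imp p (imp q r)) (imp (imp p q) (imp p r))⟩ }

/-- The single-conclusion calculus `R^⇀`: intuitionistic implication together with one axiom for
each rule of `R`. -/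
def implCalculus (imp : Formula S → Formula S → Formula S) (R : Set (Rule S)) :
    Set (SRule S) :=
  intImpRules imp ∪
    {s | ∃ r ∈ R, s = ⟨[], implForm imp (.var r.freshVar) r.prem r.concl⟩}

/-! ### The multiple-conclusion calculus `R_Σ` -/

/-- The rules for negation. -/
def negRules (hn : OLConn.neg ∈ S.ol) : Set (Rule S) :=
  let p : Formula S := .var 0
  let n := Formula.neg hn
  { ⟨[p], [n (n p)]⟩,
    ⟨[n (n p)], [p]⟩,
    ⟨[], [p, n p]⟩ }

/-- The rules for implication. -/
def impRules (hn : OLConn.neg ∈ S.ol) (h : OLConn.imp ∈ S.ol) : Set (Rule S) :=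
  let p : Formula S := .var 0
  let q : Formula S := .var 1
  let n := Formula.neg hn
  let c := Formula.imp h p q
  { ⟨[p, c], [q]⟩,
    ⟨[q], [c]⟩,
    ⟨[], [p, c]⟩,
    ⟨[p, n c], [n q]⟩,
    ⟨[n q], [n c]⟩,
    ⟨[], [p, n c]⟩ }

/-- The rules for disjunction. -/
def orRules (hn : OLConn.neg ∈ S.ol) (h : OLConn.or ∈ S.ol) : Set (Rule S) :=
  let p : Formula S := .var 0
  let q : Formula S := .var 1
  let n := Formula.neg hn
  let c := Formula.or h p q
  { ⟨[], [n p, c]⟩,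
    ⟨[], [n q, c]⟩,
    ⟨[n c], [n p]⟩,
    ⟨[n c], [n q]⟩,
    ⟨[n c, c], [p]⟩,
    ⟨[n c, c], [q]⟩,
    ⟨[n p, n q], [n c]⟩,
    ⟨[n p, c], [q]⟩,
    ⟨[n q, c], [p]⟩,
    ⟨[c], [p, q]⟩,
    ⟨[p, q], [c]⟩ }

/-- The rules for conjunction. -/
def andRules (hn : OLConn.neg ∈ S.ol) (h : OLConn.and ∈ S.ol) : Set (Rule S) :=
  let p : Formula S := .var 0
  let q : Formula S := .var 1
  let n := Formula.neg hn
  let c := Formula.and h p q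
  { ⟨[c], [p]⟩,
    ⟨[c], [q]⟩,
    ⟨[p, q], [c]⟩,
    ⟨[c, n c], [n p]⟩,
    ⟨[c, n c], [n q]⟩,
    ⟨[n p, n q], [n c]⟩,
    ⟨[p], [c, n q]⟩,
    ⟨[q], [c, n p]⟩ }

/-- Those among `φ`, `¬ φ` that are designated when `φ` has the value `x`. -/
def sepPos (hn : OLConn.neg ∈ S.ol) : O3 → Formula S → List (Formula S)
  | .zero, φ => [φ.neg hn]
  | .half, φ => [φ, φ.neg hn]
  | .one, φ => [φ]

/-- Those among `φ`, `¬ φ` that are not designated when `φ` has the value `x`. -/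
def sepNeg (hn : OLConn.neg ∈ S.ol) : O3 → Formula S → List (Formula S)
  | .zero, φ => [φ]
  | .half, _ => []
  | .one, φ => [φ.neg hn]

/-- For a connective `©` of arity `k`, values `x₁, …, xₖ` and a value `y`, the rule expressing that
`©(p₁, …, pₖ)` does not have the value `y` when each `pᵢ` has the value `xᵢ`. -/
def tableRule (hn : OLConn.neg ∈ S.ol) (c : S.Conn) (x : Fin (S.arity c) → O3) (y : O3) :
    Rule S where
  prem := (List.finRange (S.arity c)).flatMap (fun i => sepPos hn (x i) (.var i)) ++
    sepPos hn y (.app c (fun i => .var i))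
  concl := (List.finRange (S.arity c)).flatMap (fun i => sepNeg hn (x i) (.var i)) ++
    sepNeg hn y (.app c (fun i => .var i))

/-- The set of rules generated from the truth table of a connective: one rule for each tuple of
arguments and each value that is not the value of the connective at that tuple. -/
def tableRules (hn : OLConn.neg ∈ S.ol) (M : ThreeMatrix S) (c : S.Conn) : Set (Rule S) :=
  {r | ∃ (x : Fin (S.arity c) → O3) (y : O3), y ≠ M.interp c x ∧ r = tableRule hn c x y}

/-- The rules `R_©` of each connective: the finite sets given above for the connectives of `OL`, the
rules generated from the truth table for any other connective. -/
def connRules (hn : OLConn.neg ∈ S.ol) (M : ThreeMatrix S) : S.Conn → Set (Rule S)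
  | .inl ⟨.neg, _⟩ => negRules hn
  | .inl ⟨.or, h⟩ => orRules hn h
  | .inl ⟨.and, h⟩ => andRules hn h
  | .inl ⟨.imp, h⟩ => impRules hn h
  | .inr c => tableRules hn M (.inr c)

/-- The multiple-conclusion calculus `R_Σ`: the union of the `R_©` over all connectives `©` of the
signature. -/
def mcCalculus (hn : OLConn.neg ∈ S.ol) (M : ThreeMatrix S) : Set (Rule S) :=
  ⋃ c : S.Conn, connRules hn M c

end Calculi

end OrdinaryDiscourse

open OrdinaryDiscourse

/-! Soundness: `0 → y` is designated and `x → y = y` otherwise, so designation treats `→` as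
classical material implication (`imp_mem_D_iff`). The axiom attached to a multiple-conclusion rule
is therefore designated by every valuation as soon as the rule is sound, whatever the value of `p₀`.

Completeness: if `ψ` is not derivable from `Γ`, Zorn's lemma extends `Γ` to a maximal `T` not
deriving `ψ`. By the deduction theorem, `χ ∉ T` gives `χ → ψ ∈ T`. If an instance of a rule of `R_Σ`
had its premises in `T` and no conclusion in `T`, its axiom with `p₀ := ψ` would yield `ψ ∈ T` by
modus ponens. So `T` is prime for `R_Σ` (`isPrimeTheory_of_maximal`). Reading the value of `φ` off
the membership of `φ` and `¬φ` in `T`, primeness forces every truth table (`isValuation_theoryVal`),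
and this valuation designates exactly `T`: it designates `Γ` but not `ψ`. -/

namespace OrdinaryDiscourse

variable {S : Signature.{u}}

/-! ### Substitution -/

namespace Formula

@[simp] theorem subst_neg (h : OLConn.neg ∈ S.ol) (σ : ℕ → Formula S) (φ : Formula S) :
    (neg h φ).subst σ = neg h (φ.subst σ) := rfl

@[simp] theorem subst_or (h : OLConn.or ∈ S.ol) (σ : ℕ → Formula S) (φ ψ : Formula S) :
    (or h φ ψ).subst σ = or h (φ.subst σ) (ψ.subst σ) := by
  simp only [or, subst]
  congr 1
  funext i
  exact Fin.cases rfl (fun j => by fin_cases j; rfl) i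

@[simp] theorem subst_and (h : OLConn.and ∈ S.ol) (σ : ℕ → Formula S) (φ ψ : Formula S) :
    (and h φ ψ).subst σ = and h (φ.subst σ) (ψ.subst σ) := by
  simp only [and, subst]
  congr 1
  funext i
  exact Fin.cases rfl (fun j => by fin_cases j; rfl) i

@[simp] theorem subst_imp (h : OLConn.imp ∈ S.ol) (σ : ℕ → Formula S) (φ ψ : Formula S) :
    (imp h φ ψ).subst σ = imp h (φ.subst σ) (ψ.subst σ) := by
  simp only [imp, subst]
  congr 1
  funext i
  exact Fin.cases rfl (fun j => by fin_cases j; rfl) i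

/-- The homomorphism condition quantifies over arbitrary argument tuples; this lemma and its
analogues below bring them to the named constructors. -/
theorem app_neg_eq (h : OLConn.neg ∈ S.ol) (args : Fin 1 → Formula S) :
    app (.inl ⟨.neg, h⟩) args = neg h (args 0) := by
  simp only [neg]
  congr 1
  funext i
  exact congrArg args (Subsingleton.elim (α := Fin 1) _ _)

theorem fin_two_eta (args : Fin 2 → Formula S) : args = ![args 0, args 1] := by
  funext i
  fin_cases i <;> rfl

theorem app_or_eq (h : OLConn.or ∈ S.ol) (args : Fin 2 → Formula S) :
    app (.inl ⟨.or, h⟩) args = or h (args 0) (args 1) :=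
  congrArg (app (.inl ⟨.or, h⟩)) (fin_two_eta args)

theorem app_and_eq (h : OLConn.and ∈ S.ol) (args : Fin 2 → Formula S) :
    app (.inl ⟨.and, h⟩) args = and h (args 0) (args 1) :=
  congrArg (app (.inl ⟨.and, h⟩)) (fin_two_eta args)

theorem app_imp_eq (h : OLConn.imp ∈ S.ol) (args : Fin 2 → Formula S) :
    app (.inl ⟨.imp, h⟩) args = imp h (args 0) (args 1) :=
  congrArg (app (.inl ⟨.imp, h⟩)) (fin_two_eta args)

theorem subst_congr {σ τ : ℕ → Formula S} (φ : Formula S) (h : ∀ n ∈ φ.vars, σ n = τ n) :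
    φ.subst σ = φ.subst τ := by
  induction φ with
  | var n => exact h n (by simp [vars])
  | app c args ih =>
    simp only [subst]
    congr 1
    funext i
    exact ih i fun n hn => h n (by simpa only [vars, Finset.mem_biUnion, Finset.mem_univ,
      true_and] using ⟨i, hn⟩)

end Formula

theorem Rule.vars_subset (r : Rule S) {φ : Formula S} (h : φ ∈ r.prem ++ r.concl) :
    φ.vars ⊆ r.vars := by
  unfold Rule.vars
  generalize r.prem ++ r.concl = l at h
  induction l with
  | nil => simp at h
  | cons a l ih =>
    rcases List.mem_cons.1 h with rfl | h
    · exact Finset.subset_union_left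
    · exact (ih h).trans Finset.subset_union_right

/-- Every instance of a rule is obtained from a substitution with a prescribed value at the fresh
variable of the rule. -/
theorem Rule.subst_update_freshVar (r : Rule S) (σ : ℕ → Formula S) (χ : Formula S)
    {φ : Formula S} (h : φ ∈ r.prem ++ r.concl) :
    φ.subst (Function.update σ r.freshVar χ) = φ.subst σ := by
  refine Formula.subst_congr φ fun n hn => Function.update_of_ne ?_ _ _
  rintro rfl
  exact r.freshVar_notMem (r.vars_subset h hn)

theorem subst_implForm (h : OLConn.imp ∈ S.ol) (σ : ℕ → Formula S) (p₀ : Formula S)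
    (φs ψs : List (Formula S)) :
    (implForm (Formula.imp h) p₀ φs ψs).subst σ =
      implForm (Formula.imp h) (p₀.subst σ) (φs.map (·.subst σ)) (ψs.map (·.subst σ)) := by
  unfold implForm
  induction φs with
  | nil =>
    induction ψs with
    | nil => rfl
    | cons a l ih => simpa using congrArg _ ih
  | cons a l ih => simpa using congrArg _ ih

/-! ### Proof trees -/

theorem Proves.mono {R : Set (Rule S)} {Γ Δ : Set (Formula S)} (h : Proves R Γ Δ) :
    ∀ {Γ' : Set (Formula S)}, Γ ⊆ Γ' → Proves R Γ' Δ := by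
  induction h with
  | leaf h => exact fun hs => .leaf (h.mono (Set.inter_subset_inter_left _ hs))
  | node r hr σ hprem _ ih =>
    exact fun hs => .node r hr σ (fun φ hφ => hs (hprem φ hφ))
      fun ψ hψ => ih ψ hψ (Set.insert_subset_insert hs)

theorem Proves.exists_finite_subset {R : Set (Rule S)} {Γ Δ : Set (Formula S)}
    (h : Proves R Γ Δ) : ∃ F ⊆ Γ, F.Finite ∧ Proves R F Δ := by
  induction h with
  | leaf h =>
    obtain ⟨φ, hΓ, hΔ⟩ := h
    exact ⟨{φ}, by simpa using hΓ, Set.finite_singleton φ, .leaf ⟨φ, rfl, hΔ⟩⟩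
  | @node Γ Δ r hr σ hprem _ ih =>
    choose! F hF hfin hpr using ih
    -- The set used by a child may contain the conclusion added at this node, which need not lie in
    -- `Γ`; it is removed here and restored at the child.
    refine ⟨{φ | φ ∈ r.prem.map (·.subst σ)} ∪ ⋃ ψ ∈ {ψ | ψ ∈ r.concl}, F ψ \ {ψ.subst σ},
      ?_, ?_, .node r hr σ (fun φ hφ => .inl (List.mem_map_of_mem hφ)) fun ψ hψ => ?_⟩
    · refine Set.union_subset ?_ (Set.iUnion₂_subset fun ψ hψ => ?_)
      · rintro _ hφ
        obtain ⟨φ, hφ', rfl⟩ := List.mem_map.1 hφ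
        exact hprem _ hφ'
      · exact Set.sdiff_singleton_subset_iff.2 (hF ψ hψ)
    · exact (List.finite_toSet _).union
        ((List.finite_toSet _).biUnion fun ψ hψ => (hfin ψ hψ).subset Set.sdiff_subset)
    · refine (hpr ψ hψ).mono ?_
      rw [← Set.sdiff_singleton_subset_iff]
      exact (Set.subset_biUnion_of_mem (u := fun ψ => F ψ \ {ψ.subst σ}) hψ).trans
        Set.subset_union_right

/-- A set that does not prove `Δ` is contained in a maximal such set. -/
theorem exists_maximal_not_proves {R : Set (Rule S)} {Γ Δ : Set (Formula S)}
    (h : ¬ Proves R Γ Δ) : ∃ T, Γ ⊆ T ∧ Maximal (fun T => ¬ Proves R T Δ) T := by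
  refine zorn_subset_nonempty {T | ¬ Proves R T Δ} (fun c hc hchain hne => ?_) Γ h
  refine ⟨⋃₀ c, fun hp => ?_, fun s hs => Set.subset_sUnion_of_mem hs⟩
  -- A proof from the union of the chain uses finitely many formulas, all lying in one member of the
  -- chain.
  obtain ⟨F, hF, hfin, hp⟩ := hp.exists_finite_subset
  obtain ⟨t, ht, hFt⟩ :=
    DirectedOn.exists_mem_subset_of_finite_of_subset_sUnion hne hchain.directedOn hfin hF
  exact hc ht (hp.mono hFt)

/-! ### Soundness -/

namespace ThreeMatrix

variable {M : ThreeMatrix S}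

/-- Every valuation that designates all premises of the rule designates some conclusion. -/
def SoundRule (M : ThreeMatrix S) (r : Rule S) : Prop :=
  ∀ v, M.IsValuation v → (∀ φ ∈ r.prem, v φ ∈ M.D) → ∃ ψ ∈ r.concl, v ψ ∈ M.D

/-- Absorbing the substitution into the valuation reduces soundness of all instances of a rule to
`SoundRule`, which concerns the schema alone. -/
theorem IsValuation.comp_subst {v : Formula S → O3} (hv : M.IsValuation v)
    (σ : ℕ → Formula S) : M.IsValuation fun φ => v (φ.subst σ) :=
  fun _ _ => hv _ _

theorem exists_mem_of_proves {R : Set (Rule S)} (hR : ∀ r ∈ R, M.SoundRule r)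
    {v : Formula S → O3} (hv : M.IsValuation v) {Γ Δ : Set (Formula S)} (h : Proves R Γ Δ)
    (hΓ : ∀ φ ∈ Γ, v φ ∈ M.D) : ∃ ψ ∈ Δ, v ψ ∈ M.D := by
  induction h with
  | leaf h =>
    obtain ⟨φ, h1, h2⟩ := h
    exact ⟨φ, h2, hΓ φ h1⟩
  | node r hr σ hprem _ ih =>
    obtain ⟨ψ, hψ, hd⟩ := hR r hr _ (hv.comp_subst σ) fun φ hφ => hΓ _ (hprem φ hφ)
    exact ih ψ hψ fun φ hφ => hφ.elim (fun e => e ▸ hd) (hΓ φ)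

section OL

variable (hM : M.IsOLMatrix) {v : Formula S → O3} (hv : M.IsValuation v)
include hM

theorem IsOLMatrix.mem_D_iff (x : O3) : x ∈ M.D ↔ x ≠ .zero := by
  rw [hM.2]
  cases x <;> simp

include hv

theorem IsOLMatrix.val_neg (h : OLConn.neg ∈ S.ol) (φ : Formula S) :
    v (φ.neg h) = (v φ).neg := by
  rw [Formula.neg, hv, hM.1]
  rfl

theorem IsOLMatrix.val_or (h : OLConn.or ∈ S.ol) (φ ψ : Formula S) :
    v (φ.or h ψ) = (v φ).or (v ψ) := by
  rw [Formula.or, hv, hM.1]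
  rfl

theorem IsOLMatrix.val_and (h : OLConn.and ∈ S.ol) (φ ψ : Formula S) :
    v (φ.and h ψ) = (v φ).and (v ψ) := by
  rw [Formula.and, hv, hM.1]
  rfl

theorem IsOLMatrix.val_imp (h : OLConn.imp ∈ S.ol) (φ ψ : Formula S) :
    v (φ.imp h ψ) = (v φ).imp (v ψ) := by
  rw [Formula.imp, hv, hM.1]
  rfl

theorem IsOLMatrix.imp_mem_D_iff (h : OLConn.imp ∈ S.ol) (φ ψ : Formula S) :
    v (φ.imp h ψ) ∈ M.D ↔ (v φ ∈ M.D → v ψ ∈ M.D) := by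
  rw [hM.val_imp hv]
  simp only [hM.mem_D_iff]
  cases v φ <;> cases v ψ <;> simp [O3.imp]

theorem IsOLMatrix.implForm_mem_D_iff (h : OLConn.imp ∈ S.ol) (p₀ : Formula S)
    (φs ψs : List (Formula S)) :
    v (implForm (Formula.imp h) p₀ φs ψs) ∈ M.D ↔
      ((∀ φ ∈ φs, v φ ∈ M.D) → (∀ ψ ∈ ψs, v ψ ∈ M.D → v p₀ ∈ M.D) → v p₀ ∈ M.D) := by
  unfold implForm
  induction φs with
  | nil =>
    induction ψs with
    | nil => simp
    | cons a l ih =>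
      simp only [List.foldr_cons, List.foldr_nil, hM.imp_mem_D_iff hv] at ih ⊢
      rw [ih]
      simp
  | cons a l ih =>
    simp only [List.foldr_cons, hM.imp_mem_D_iff hv]
    rw [ih]
    simp only [List.forall_mem_cons]
    tauto

/-- The pair `φ`, `¬φ` separates the three values: only `¬φ` is designated at `0`, both at `1/2`,
only `φ` at `1`. -/
theorem IsOLMatrix.val_eq_of_sep (hn : OLConn.neg ∈ S.ol) (φ : Formula S) {y : O3}
    (hpos : ∀ χ ∈ sepPos hn y φ, v χ ∈ M.D) (hneg : ∀ χ ∈ sepNeg hn y φ, v χ ∉ M.D) :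
    v φ = y := by
  cases y <;> simp [sepPos, sepNeg, hM.mem_D_iff, hM.val_neg hv] at hpos hneg ⊢ <;>
    revert hpos hneg <;> cases v φ <;> simp [O3.neg]

omit hv in
-- A valuation refuting the rule would give the arguments the values `x` and the compound the value
-- `y`, against the table.
theorem IsOLMatrix.soundRule_tableRule (hn : OLConn.neg ∈ S.ol) (c : S.Conn)
    {x : Fin (S.arity c) → O3} {y : O3} (hy : y ≠ M.interp c x) :
    M.SoundRule (tableRule hn c x y) := by
  intro v hv hprem
  by_contra! hcon
  simp only [tableRule, List.mem_append, List.mem_flatMap, List.mem_finRange, true_and]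
    at hprem hcon
  refine hy ?_
  rw [← hM.val_eq_of_sep hv hn _ (fun χ h => hprem χ (.inr h)) (fun χ h => hcon χ (.inr h)), hv]
  congr 1
  funext i
  exact hM.val_eq_of_sep hv hn _ (fun χ h => hprem χ (.inl ⟨i, h⟩))
    (fun χ h => hcon χ (.inl ⟨i, h⟩))

omit hv in
theorem IsOLMatrix.soundRule_connRules_inl (hn : OLConn.neg ∈ S.ol) (c : S.ol) :
    ∀ r ∈ connRules hn M (.inl c), M.SoundRule r := by
  obtain ⟨c, h⟩ := c
  cases c <;>
    simp only [connRules, negRules, orRules, andRules, impRules, Set.mem_insert_iff,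
      Set.mem_singleton_iff, forall_eq_or_imp, forall_eq]
  all_goals
    repeat' apply And.intro
  all_goals
    intro v hv
    simp only [List.forall_mem_cons, List.exists_mem_cons_iff, List.not_mem_nil, false_and,
      exists_false, or_false, IsEmpty.forall_iff, implies_true, and_true, true_imp_iff,
      hM.mem_D_iff, hM.val_neg hv, hM.val_or hv, hM.val_and hv, hM.val_imp hv]
    cases v (.var 0) <;> try cases v (.var 1)
  all_goals simp [O3.neg, O3.or, O3.and, O3.imp]

omit hv in
theorem IsOLMatrix.soundRule_mcCalculus (hn : OLConn.neg ∈ S.ol) {r : Rule S}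
    (hr : r ∈ mcCalculus hn M) : M.SoundRule r := by
  obtain ⟨c | c, hc⟩ := Set.mem_iUnion.1 hr
  · exact hM.soundRule_connRules_inl hn c r hc
  · obtain ⟨x, y, hy, rfl⟩ := hc
    exact hM.soundRule_tableRule hn _ hy

omit hv in
theorem IsOLMatrix.soundRule_implCalculus (hn : OLConn.neg ∈ S.ol) (hi : OLConn.imp ∈ S.ol)
    {s : SRule S} (hs : s ∈ implCalculus (Formula.imp hi) (mcCalculus hn M)) :
    M.SoundRule s.toRule := by
  intro v hv
  rcases hs with (rfl | rfl | rfl) | ⟨r, hr, rfl⟩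
  · simp only [SRule.toRule, List.forall_mem_cons, List.mem_singleton, exists_eq_left, forall_eq,
      hM.imp_mem_D_iff hv]
    tauto
  · simp only [SRule.toRule, List.mem_singleton, exists_eq_left, hM.imp_mem_D_iff hv]
    tauto
  · simp only [SRule.toRule, List.mem_singleton, exists_eq_left, hM.imp_mem_D_iff hv]
    tauto
  · simp only [SRule.toRule, List.mem_singleton, exists_eq_left, hM.implForm_mem_D_iff hv]
    intro _ hprem hconcl
    obtain ⟨ψ, hψ, hd⟩ := hM.soundRule_mcCalculus hn hr v hv hprem
    exact hconcl ψ hψ hd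

end OL

end ThreeMatrix

/-! ### Theories that are prime with respect to a multiple-conclusion calculus -/

/-- `T` meets the conclusions of every instance of a rule of `R` whose premises it contains. -/
def IsPrimeTheory (R : Set (Rule S)) (T : Set (Formula S)) : Prop :=
  ∀ r ∈ R, ∀ σ : ℕ → Formula S, (∀ φ ∈ r.prem, φ.subst σ ∈ T) → ∃ ψ ∈ r.concl, ψ.subst σ ∈ T

/-- A maximal set that does not derive `ψ` is closed under the rules. -/
theorem concl_mem_of_maximal {R : Set (SRule S)} {T : Set (Formula S)} {ψ : Formula S}
    (hT : Maximal (fun T => ¬ Derives R T ψ) T) {s : SRule S} (hs : s ∈ R)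
    (σ : ℕ → Formula S) (hprem : ∀ φ ∈ s.prem, φ.subst σ ∈ T) : s.concl.subst σ ∈ T := by
  refine hT.mem_of_prop_insert fun hd => hT.prop ?_
  refine .node s.toRule ⟨s, hs, rfl⟩ σ hprem fun χ hχ => ?_
  obtain rfl := List.mem_singleton.1 hχ
  exact hd

section Implication

variable (hi : OLConn.imp ∈ S.ol) {R : Set (Rule S)} {T : Set (Formula S)}

/-- Closure under every instance of the rules of the implicational calculus of `R`. -/
def IsClosedTheory (hi : OLConn.imp ∈ S.ol) (R : Set (Rule S)) (T : Set (Formula S)) : Prop :=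
  ∀ s ∈ implCalculus (Formula.imp hi) R, ∀ σ : ℕ → Formula S,
    (∀ φ ∈ s.prem, φ.subst σ ∈ T) → s.concl.subst σ ∈ T

/-- The substitution that sends the first three variables to the given formulas. -/
def substThree (φ ψ χ : Formula S) : ℕ → Formula S
  | 0 => φ
  | 1 => ψ
  | _ => χ

variable {hi}

namespace IsClosedTheory

variable (hT : IsClosedTheory hi R T)
include hT

theorem mp {φ ψ : Formula S} (h1 : φ ∈ T) (h2 : φ.imp hi ψ ∈ T) : ψ ∈ T := by
  have := hT _ (.inl (.inl rfl)) (substThree φ ψ ψ)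
  simp only [List.forall_mem_cons, Formula.subst_imp, Formula.subst, substThree] at this
  exact this ⟨h1, h2, by simp⟩

theorem weaken (φ ψ : Formula S) : φ.imp hi (ψ.imp hi φ) ∈ T := by
  simpa [Formula.subst, substThree] using hT _ (.inl (.inr (.inl rfl))) (substThree φ ψ ψ)

theorem distrib (φ ψ χ : Formula S) :
    (φ.imp hi (ψ.imp hi χ)).imp hi ((φ.imp hi ψ).imp hi (φ.imp hi χ)) ∈ T := by
  simpa [Formula.subst, substThree] using hT _ (.inl (.inr (.inr rfl))) (substThree φ ψ χ)

theorem imp_of_mem {ψ : Formula S} (φ : Formula S) (h : ψ ∈ T) : φ.imp hi ψ ∈ T :=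
  hT.mp h (hT.weaken ψ φ)

theorem imp_mp {φ ψ χ : Formula S} (h1 : φ.imp hi ψ ∈ T) (h2 : φ.imp hi (ψ.imp hi χ) ∈ T) :
    φ.imp hi χ ∈ T :=
  hT.mp h1 (hT.mp h2 (hT.distrib φ ψ χ))

/-- This is the combinator term `S K K`. -/
theorem imp_self (φ : Formula S) : φ.imp hi φ ∈ T :=
  hT.imp_mp (hT.weaken φ φ) (hT.weaken φ (φ.imp hi φ))

/-- The deduction theorem. -/
theorem imp_mem_of_derives {Γ Δ : Set (Formula S)} {χ ψ : Formula S}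
    (h : Proves (SRule.toRule '' implCalculus (Formula.imp hi) R) Γ Δ) (hΔ : Δ = {ψ})
    (hΓ : ∀ φ ∈ Γ, χ.imp hi φ ∈ T) : χ.imp hi ψ ∈ T := by
  induction h with
  | leaf h =>
    obtain ⟨φ, h1, h2⟩ := h
    obtain rfl : φ = ψ := by simpa [hΔ] using h2
    exact hΓ φ h1
  | node r hr σ hprem _ ih =>
    obtain ⟨s, hs, rfl⟩ := hr
    -- The invariant `χ → φ ∈ T` for all `φ` in the label has to be extended to the conclusion that
    -- the rule adds.
    refine ih s.concl (by simp [SRule.toRule]) hΔ fun φ hφ => hφ.elim (fun e => e ▸ ?_) (hΓ φ)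
    -- Modus ponens is the only rule of the calculus with premises.
    have axiom_case (hp : s.prem = []) : χ.imp hi (s.concl.subst σ) ∈ T :=
      hT.imp_of_mem χ (hT s hs σ (by simp [hp]))
    rcases hs with (rfl | rfl | rfl) | ⟨r, hr, rfl⟩
    · have h1 := hΓ _ (hprem (.var 0) (by simp [SRule.toRule]))
      have h2 := hΓ _ (hprem (.imp hi (.var 0) (.var 1)) (by simp [SRule.toRule]))
      rw [Formula.subst_imp] at h2
      exact hT.imp_mp h1 h2
    all_goals exact axiom_case rfl

theorem of_implForm {p₀ : Formula S} {φs ψs : List (Formula S)}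
    (h : implForm (Formula.imp hi) p₀ φs ψs ∈ T) (hφ : ∀ φ ∈ φs, φ ∈ T)
    (hψ : ∀ ψ ∈ ψs, ψ.imp hi p₀ ∈ T) : p₀ ∈ T := by
  unfold implForm at h
  induction φs with
  | nil =>
    induction ψs with
    | nil => exact h
    | cons a l ih =>
      rw [List.forall_mem_cons] at hψ
      exact ih hψ.2 (hT.mp hψ.1 h)
  | cons a l ih =>
    rw [List.forall_mem_cons] at hφ
    exact ih (hT.mp hφ.1 h) hφ.2

end IsClosedTheory

/-- The formula `ψ` plays the role of falsum: each `χ` outside `T` satisfies `χ → ψ ∈ T`, so no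
disjunction is needed to express several conclusions. -/
theorem isPrimeTheory_of_maximal {ψ : Formula S}
    (hmax : Maximal (fun T => ¬ Derives (implCalculus (Formula.imp hi) R) T ψ) T) :
    IsPrimeTheory R T := by
  have hT : IsClosedTheory hi R T := fun s hs σ => concl_mem_of_maximal hmax hs σ
  have himp {χ : Formula S} (hχ : χ ∉ T) : χ.imp hi ψ ∈ T := by
    have hd : Derives (implCalculus (Formula.imp hi) R) (insert χ T) ψ := by
      by_contra hd
      exact hχ (hmax.mem_of_prop_insert hd)
    refine hT.imp_mem_of_derives hd rfl fun φ hφ => ?_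
    exact hφ.elim (fun e => e ▸ hT.imp_self φ) (hT.imp_of_mem χ)
  intro r hr σ hprem
  by_contra! hcon
  refine hmax.prop (.leaf ⟨ψ, ?_, rfl⟩)
  -- Since `p₀` is fresh, it can be sent to `ψ` without disturbing the instance of the rule.
  have hax := hT _ (.inr ⟨r, hr, rfl⟩) (Function.update σ r.freshVar ψ) (by simp)
  rw [subst_implForm, Formula.subst, Function.update_self] at hax
  refine hT.of_implForm hax ?_ ?_
  · simp only [List.forall_mem_map]
    intro φ hφ
    rw [r.subst_update_freshVar σ ψ (List.mem_append_left _ hφ)]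
    exact hprem φ hφ
  · simp only [List.forall_mem_map]
    intro φ hφ
    rw [r.subst_update_freshVar σ ψ (List.mem_append_right _ hφ)]
    exact himp (hcon φ hφ)

end Implication

/-! ### The valuation of a prime theory -/

open Classical in
/-- The value of `φ` determined by which of `φ`, `¬ φ` belong to `T`. -/
noncomputable def theoryVal (hn : OLConn.neg ∈ S.ol) (T : Set (Formula S)) (φ : Formula S) : O3 :=
  if φ ∈ T then if φ.neg hn ∈ T then .half else .one else .zero

section Valuation

variable {hn : OLConn.neg ∈ S.ol} {M : ThreeMatrix S} {T : Set (Formula S)}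

theorem subst_sepPos (x : O3) (φ : Formula S) (σ : ℕ → Formula S) :
    (sepPos hn x φ).map (·.subst σ) = sepPos hn x (φ.subst σ) := by
  cases x <;> rfl

theorem subst_sepNeg (x : O3) (φ : Formula S) (σ : ℕ → Formula S) :
    (sepNeg hn x φ).map (·.subst σ) = sepNeg hn x (φ.subst σ) := by
  cases x <;> rfl

theorem theoryVal_ne_zero_iff {φ : Formula S} : theoryVal hn T φ ≠ .zero ↔ φ ∈ T := by
  unfold theoryVal
  split_ifs <;> simp_all

variable (hT : IsPrimeTheory (mcCalculus hn M) T)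
include hT

theorem IsPrimeTheory.conn (c : S.Conn) : IsPrimeTheory (connRules hn M c) T :=
  fun r hr => hT r (Set.mem_iUnion_of_mem c hr)

/-- This excludes the fourth case, neither formula in `T`, which `theoryVal` would also send to `0`.
-/
theorem IsPrimeTheory.mem_or_neg_mem (φ : Formula S) : φ ∈ T ∨ φ.neg hn ∈ T := by
  have := hT.conn (.inl ⟨.neg, hn⟩) ⟨[], [.var 0, .neg hn (.var 0)]⟩ (.inr (.inr rfl))
    (fun _ => φ)
  simpa [Formula.subst] using this

theorem IsPrimeTheory.mem_of_mem_sepPos {φ χ : Formula S}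
    (h : χ ∈ sepPos hn (theoryVal hn T φ) φ) : χ ∈ T := by
  have := hT.mem_or_neg_mem φ
  unfold theoryVal at h
  split_ifs at h <;> simp [sepPos] at h <;> aesop

omit hT in
theorem notMem_of_mem_sepNeg {φ χ : Formula S}
    (h : χ ∈ sepNeg hn (theoryVal hn T φ) φ) : χ ∉ T := by
  unfold theoryVal at h
  split_ifs at h <;> simp [sepNeg] at h <;> aesop

/-- A wrong value `y` of the compound would violate the table rule for that `y` and the values of
the arguments: its premises lie in `T`, its conclusions do not. -/
theorem IsPrimeTheory.theoryVal_extra (c : S.Extra)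
    (args : Fin (S.arity (.inr c)) → Formula S) :
    theoryVal hn T (.app (.inr c) args) =
      M.interp (.inr c) (fun i => theoryVal hn T (args i)) := by
  by_contra hne
  -- Variables beyond the arity do not occur in the rule, so their images are irrelevant.
  let σ : ℕ → Formula S :=
    fun n => if h : n < S.arity (.inr c) then args ⟨n, h⟩ else .var n
  have hσ (i : Fin (S.arity (.inr c))) : (Formula.var (S := S) i).subst σ = args i := by
    simp [Formula.subst, σ]
  have happ : (Formula.app (S := S) (.inr c) fun i => .var i).subst σ = .app (.inr c) args := by
    rw [Formula.subst]
    congr 1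
    funext i
    exact hσ i
  obtain ⟨ψ, hψ, hmem⟩ := hT.conn (.inr c) _ ⟨_, _, hne, rfl⟩ σ (by
    simp only [tableRule, List.mem_append, List.mem_flatMap, List.mem_finRange, true_and]
    rintro φ (⟨i, hφ⟩ | hφ)
    · have := List.mem_map_of_mem (f := (·.subst σ)) hφ
      rw [subst_sepPos, hσ] at this
      exact hT.mem_of_mem_sepPos this
    · have := List.mem_map_of_mem (f := (·.subst σ)) hφ
      rw [subst_sepPos, happ] at this
      exact hT.mem_of_mem_sepPos this)
  simp only [tableRule, List.mem_append, List.mem_flatMap, List.mem_finRange, true_and] at hψ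
  obtain ⟨i, hψ⟩ | hψ := hψ
  · have := List.mem_map_of_mem (f := (·.subst σ)) hψ
    rw [subst_sepNeg, hσ] at this
    exact notMem_of_mem_sepNeg this hmem
  · have := List.mem_map_of_mem (f := (·.subst σ)) hψ
    rw [subst_sepNeg, happ] at this
    exact notMem_of_mem_sepNeg this hmem

theorem IsPrimeTheory.theoryVal_neg (φ : Formula S) :
    theoryVal hn T (φ.neg hn) = (theoryVal hn T φ).neg := by
  have hφ := hT.mem_or_neg_mem φ
  have h := fun r hr => hT.conn (.inl ⟨.neg, hn⟩) r hr (substThree φ φ φ)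
  simp only [connRules, negRules, Set.mem_insert_iff, Set.mem_singleton_iff, forall_eq_or_imp,
    forall_eq, List.forall_mem_cons, List.exists_mem_cons_iff, List.not_mem_nil, false_and,
    exists_false, or_false, IsEmpty.forall_iff, implies_true, and_true, true_imp_iff,
    Formula.subst_neg, Formula.subst, substThree] at h
  simp only [theoryVal]
  split_ifs <;> simp_all [O3.neg]

theorem IsPrimeTheory.theoryVal_or (hc : OLConn.or ∈ S.ol) (φ ψ : Formula S) :
    theoryVal hn T (φ.or hc ψ) = (theoryVal hn T φ).or (theoryVal hn T ψ) := by
  have hφ := hT.mem_or_neg_mem φ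
  have hψ := hT.mem_or_neg_mem ψ
  have hφψ := hT.mem_or_neg_mem (φ.or hc ψ)
  -- Each rule becomes a clause about membership in `T` of the arguments, the compound and their
  -- negations; together with the three dichotomies above, these clauses exclude every entry off the
  -- table.
  have h := fun r hr => hT.conn (.inl ⟨.or, hc⟩) r hr (substThree φ ψ ψ)
  simp only [connRules, orRules, Set.mem_insert_iff, Set.mem_singleton_iff, forall_eq_or_imp,
    forall_eq, List.forall_mem_cons, List.exists_mem_cons_iff, List.not_mem_nil, false_and,
    exists_false, or_false, IsEmpty.forall_iff, implies_true, and_true, true_imp_iff,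
    Formula.subst_neg, Formula.subst_or, Formula.subst, substThree] at h
  simp only [theoryVal]
  split_ifs <;> simp_all [O3.or]

theorem IsPrimeTheory.theoryVal_and (hc : OLConn.and ∈ S.ol) (φ ψ : Formula S) :
    theoryVal hn T (φ.and hc ψ) = (theoryVal hn T φ).and (theoryVal hn T ψ) := by
  have hφ := hT.mem_or_neg_mem φ
  have hψ := hT.mem_or_neg_mem ψ
  have hφψ := hT.mem_or_neg_mem (φ.and hc ψ)
  have h := fun r hr => hT.conn (.inl ⟨.and, hc⟩) r hr (substThree φ ψ ψ)
  simp only [connRules, andRules, Set.mem_insert_iff, Set.mem_singleton_iff, forall_eq_or_imp,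
    forall_eq, List.forall_mem_cons, List.exists_mem_cons_iff, List.not_mem_nil, false_and,
    exists_false, or_false, IsEmpty.forall_iff, implies_true, and_true,
    Formula.subst_neg, Formula.subst_and, Formula.subst, substThree] at h
  simp only [theoryVal]
  split_ifs <;> simp_all [O3.and]

theorem IsPrimeTheory.theoryVal_imp (hc : OLConn.imp ∈ S.ol) (φ ψ : Formula S) :
    theoryVal hn T (φ.imp hc ψ) = (theoryVal hn T φ).imp (theoryVal hn T ψ) := by
  have hφ := hT.mem_or_neg_mem φ
  have hψ := hT.mem_or_neg_mem ψ
  have hφψ := hT.mem_or_neg_mem (φ.imp hc ψ)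
  have h := fun r hr => hT.conn (.inl ⟨.imp, hc⟩) r hr (substThree φ ψ ψ)
  simp only [connRules, impRules, Set.mem_insert_iff, Set.mem_singleton_iff, forall_eq_or_imp,
    forall_eq, List.forall_mem_cons, List.exists_mem_cons_iff, List.not_mem_nil, false_and,
    exists_false, or_false, IsEmpty.forall_iff, implies_true, and_true, true_imp_iff,
    Formula.subst_neg, Formula.subst_imp, Formula.subst, substThree] at h
  simp only [theoryVal]
  split_ifs <;> simp_all [O3.imp]

theorem IsPrimeTheory.isValuation_theoryVal (hM : M.IsOLMatrix) :
    M.IsValuation (theoryVal hn T) := by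
  rintro (⟨c, hc⟩ | c) args
  · rw [hM.1]
    cases c
    · exact (congrArg _ (Formula.app_neg_eq hc args)).trans (hT.theoryVal_neg _)
    · exact (congrArg _ (Formula.app_or_eq hc args)).trans (hT.theoryVal_or hc _ _)
    · exact (congrArg _ (Formula.app_and_eq hc args)).trans (hT.theoryVal_and hc _ _)
    · exact (congrArg _ (Formula.app_imp_eq hc args)).trans (hT.theoryVal_imp hc _ _)
  · exact hT.theoryVal_extra c args

end Valuation

end OrdinaryDiscourse

/-! ### Completeness and soundness combined -/

theorem mainTheorem4 (S : Signature.{u})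
    (hneg : OLConn.neg ∈ S.ol) (himp : OLConn.imp ∈ S.ol)
    (M : ThreeMatrix S) (hM : M.IsOLMatrix) :
    Axiomatizes (implCalculus (Formula.imp himp) (mcCalculus hneg M)) M.Entails := by
  intro Γ ψ
  constructor
  · intro hent
    by_contra hnd
    obtain ⟨T, hΓ, hmax⟩ := exists_maximal_not_proves hnd
    have hT : IsPrimeTheory (mcCalculus hneg M) T := isPrimeTheory_of_maximal (hi := himp) hmax
    refine hent ⟨theoryVal hneg T, hT.isValuation_theoryVal hM, fun φ hφ => ?_, fun hψ => ?_⟩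
    · exact (hM.mem_D_iff _).2 (theoryVal_ne_zero_iff.2 (hΓ hφ))
    · have hmem : ψ ∈ T := theoryVal_ne_zero_iff.1 ((hM.mem_D_iff _).1 hψ)
      exact hmax.prop (.leaf ⟨ψ, hmem, rfl⟩)
  · rintro hd ⟨v, hv, hΓ, hψ⟩
    have hR : ∀ r ∈ SRule.toRule '' implCalculus (Formula.imp himp) (mcCalculus hneg M),
        M.SoundRule r := by
      rintro _ ⟨s, hs, rfl⟩
      exact hM.soundRule_implCalculus hneg himp hs
    obtain ⟨χ, hχ, hmem⟩ := ThreeMatrix.exists_mem_of_proves hR hv hd hΓ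
    obtain rfl : χ = ψ := hχ
    exact hψ hmem
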